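/- Let $n, d$ be natural numbers (in particular $d\in\{2,3\}$ and $n\ge d$), and let $c_1,\dots,c_n>0$ be fixed. For $r=(r_1,\dots,r_n)\in\mathbb{R}^{dn}$ with all $r_i\in\mathbb{R}^d\setminus\{0\}$, put $$g_i=\frac{r_i}{\|r_i\|},\qquad G=\sum_{i=1}^n c_i^2\,g_ig_i^T,\qquad P_i=I_d-g_ig_i^T .$$ Let $r(0)\in\mathbb{R}^{dn}$ be any initial condition with $\|r_i(0)\|\neq 0$ for all $i\in\{1,\dots,n\}$. Then the gradient dynamics $$\dot r_i=-P_iGg_i,\qquad i=1,\dots,n,$$ have a solution $r(t)$ on $[0,\infty)$ with this initial condition; it is unique, in the sense that every solution on an interval $[0,T)$ with the same initial condition is a restriction of it. The sensor ranges are conserved along it: $\|r_i(t)\|=\|r_i(0)\|$ for all $t\ge0$ and all $i$, that is, $r(t)$ stays in the product of spheres $$\mathcal{S}=\{r\in\mathbb{R}^{dn}:\ \|r_i\|=\|r_i(0)\|,\ i=1,\dots,n\}.$$ Moreover, $r(t)$ asymptotically converges to the critical set $$\mathcal{E}=\{r\in\mathcal{S}:\ P_iGg_i=0,\ i=1,\dots,n\},$$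 that is, for every $\varepsilon>0$ there is a time $T$ such that for every $t\ge T$ there is a point of $\mathcal{E}$ at Euclidean distance less than $\varepsilon$ from $r(t)$. -/

import Mathlib

open Set Filter Topology

namespace SensorPlacement

/-- Configurations `r = (r_1, …, r_n)` of `n` relative sensor positions `r_i ∈ ℝ^d`, with the
Euclidean norm of `ℝ^{dn}`. -/
abbrev Config (n d : ℕ) : Type :=
  PiLp 2 (fun _ : Fin n => EuclideanSpace ℝ (Fin d))

variable {n d : ℕ}

/-- The bearing `g_i = r_i / ‖r_i‖` of sensor `i` (meaningful when `r_i ≠ 0`). -/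
noncomputable def bearing (r : Config n d) (i : Fin n) : EuclideanSpace ℝ (Fin d) :=
  ‖r i‖⁻¹ • r i

/-- The matrix `G = ∑ i, c_i² g_i g_iᵀ`. -/
noncomputable def matG (c : Fin n → ℝ) (r : Config n d) : Matrix (Fin d) (Fin d) ℝ :=
  ∑ i, c i ^ 2 • Matrix.vecMulVec (bearing r i).ofLp (bearing r i).ofLp

/-- The matrix `P_i = I_d - g_i g_iᵀ`. -/
noncomputable def matP (r : Config n d) (i : Fin n) : Matrix (Fin d) (Fin d) ℝ :=
  1 - Matrix.vecMulVec (bearing r i).ofLp (bearing r i).ofLp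

/-- The vector `P_i G g_i ∈ ℝ^d`. -/
noncomputable def projGrad (c : Fin n → ℝ) (r : Config n d) (i : Fin n) :
    EuclideanSpace ℝ (Fin d) :=
  Matrix.toEuclideanCLM (𝕜 := ℝ) (matP r i * matG c r) (bearing r i)

/-- The right-hand side of the closed-loop system `ṙ_i = -P_i G g_i`, `i = 1, …, n`. -/
noncomputable def gradField (c : Fin n → ℝ) (r : Config n d) : Config n d :=
  WithLp.toLp 2 (fun i => -projGrad c r i)

/-- `r` solves `ṙ_i = -P_i G g_i` on the time set `J` with initial value `r₀` at time `0`
(one-sided derivatives at endpoints of `J` that belong to `J`). -/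
def IsSolution (c : Fin n → ℝ) (r₀ : Config n d) (J : Set ℝ) (r : ℝ → Config n d) : Prop :=
  r 0 = r₀ ∧ IsIntegralCurveOn r (fun _ => gradField c) J

/-- The product of spheres `𝓢 = {r : ‖r_i‖ = ‖r_i(0)‖, i = 1, …, n}`. -/
def spheres (r₀ : Config n d) : Set (Config n d) :=
  {r | ∀ i, ‖r i‖ = ‖r₀ i‖}

/-- The critical set `𝓔 = {r ∈ 𝓢 : P_i G g_i = 0, i = 1, …, n}`. -/
def critSet (c : Fin n → ℝ) (r₀ : Config n d) : Set (Config n d) :=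
  {r | r ∈ spheres r₀ ∧ ∀ i, projGrad c r i = 0}

/-- `r(t)` approaches the set `M` as `t → ∞`: for every `ε > 0` there is a time after which `r(t)`
is at distance less than `ε` from some point of `M`. -/
def ApproachesSet (r : ℝ → Config n d) (M : Set (Config n d)) : Prop :=
  ∀ ε > 0, ∃ T : ℝ, ∀ t ≥ T, ∃ e ∈ M, dist (r t) e < ε

end SensorPlacement

/-! The field is orthogonal to each `r i`, so ranges are conserved. On the product of spheres the
potential `¼ ∑ c_j² c_k² ⟪g_j, g_k⟫² = ¼ tr G²` has derivative `-∑ c_i² ‖r_i(0)‖⁻¹ ‖ṙ_i‖²` along the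
flow, and this vanishes only on the critical set. Since the potential is bounded below, a
LaSalle-type argument (`eventually_mem_thickening_of_dissipation`) gives convergence.

The field is singular where some `r i = 0`. Freezing the ranges makes it polynomial, and a cutoff
makes it bounded and Lipschitz (`exists_lipschitz_extension`). The global curve of this extension
never leaves the spheres, where the two fields agree. A competing solution conserves its ranges too,
so it also solves the extended equation, and uniqueness is inherited from there. -/

open scoped NNReal

/-! ### Global existence for bounded Lipschitz fields -/

section GlobalFlow

variable {E : Type*} [NormedAddCommGroup E] [NormedSpace ℝ E] [CompleteSpace E]

/-- A bounded, globally Lipschitz vector field on a Banach space has a global integral curve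
through every point. -/
theorem exists_isIntegralCurve_of_lipschitzWith {f : E → E} {K L : ℝ≥0}
    (hf : LipschitzWith K f) (hb : ∀ x, ‖f x‖ ≤ L) (x₀ : E) :
    ∃ γ : ℝ → E, γ 0 = x₀ ∧ IsIntegralCurve γ (fun _ => f) := by
  have key : ∀ N : ℕ, ∃ α : ℝ → E, α 0 = x₀ ∧
      ∀ t ∈ Ioo (-((N : ℝ) + 1)) ((N : ℝ) + 1), HasDerivAt α (f (α t)) t := by
    intro N
    have h0 : (0 : ℝ) ∈ Icc (-((N : ℝ) + 1)) ((N : ℝ) + 1) := by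
      constructor <;> linarith [N.cast_nonneg (α := ℝ)]
    -- At speed at most `L`, a curve moves at most `L * (N + 1)` in time `N + 1`; as the bounds are
    -- global, every `N` is admissible.
    have hp : IsPicardLindelof (fun _ => f) (⟨0, h0⟩ : Icc (-((N : ℝ) + 1)) ((N : ℝ) + 1))
        x₀ (L * (N + 1)) 0 L K :=
      .of_time_independent (fun x _ => hb x) hf.lipschitzOnWith (by simp)
    obtain ⟨α, hα0, hα⟩ := hp.exists_eq_forall_mem_Icc_hasDerivWithinAt₀
    exact ⟨α, hα0, fun t ht => (hα t (Ioo_subset_Icc_self ht)).hasDerivAt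
      (Icc_mem_nhds ht.1 ht.2)⟩
  choose α hα0 hα using key
  have agree : ∀ M N : ℕ, M ≤ N → EqOn (α M) (α N) (Ioo (-((M : ℝ) + 1)) ((M : ℝ) + 1)) := by
    intro M N hMN
    have hMN' : (M : ℝ) ≤ N := by exact_mod_cast hMN
    have hM := M.cast_nonneg (α := ℝ)
    refine ODE_solution_unique_of_mem_Ioo (v := fun _ => f) (s := fun _ => univ) (K := K)
      (t₀ := 0) (fun _ _ => hf.lipschitzOnWith) ⟨by linarith, by linarith⟩
      (fun t ht => ⟨hα M t ht, mem_univ _⟩)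
      (fun t ht => ⟨hα N t ⟨by linarith [ht.1], by linarith [ht.2]⟩, mem_univ _⟩)
      ((hα0 M).trans (hα0 N).symm)
  have glue : ∀ N : ℕ, EqOn (fun t => α ⌈|t|⌉₊ t) (α N) (Ioo (-((N : ℝ) + 1)) ((N : ℝ) + 1)) := by
    intro N t ht
    have hlt : |t| < (⌈|t|⌉₊ : ℝ) + 1 := by linarith [Nat.le_ceil |t|]
    rcases le_total ⌈|t|⌉₊ N with h | h
    · exact agree _ _ h (abs_lt.1 hlt)
    · exact (agree _ _ h ht).symm
  refine ⟨fun t => α ⌈|t|⌉₊ t, by simp [hα0], fun t => ?_⟩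
  have ht : t ∈ Ioo (-((⌈|t|⌉₊ : ℝ) + 1)) ((⌈|t|⌉₊ : ℝ) + 1) :=
    abs_lt.1 (by linarith [Nat.le_ceil |t|])
  exact (hα _ t ht).congr_of_eventuallyEq ((glue _).eventuallyEq_of_mem (Ioo_mem_nhds ht.1 ht.2))

end GlobalFlow

/-! ### Integral curves and uniqueness -/

section IntegralCurve

variable {E F : Type*} [NormedAddCommGroup E] [NormedSpace ℝ E] [NormedAddCommGroup F]
  [NormedSpace ℝ F] {γ : ℝ → E} {v w : ℝ → E → E} {J : Set ℝ}

theorem IsIntegralCurveOn.congr_field (h : IsIntegralCurveOn γ v J)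
    (hvw : ∀ t ∈ J, v t (γ t) = w t (γ t)) : IsIntegralCurveOn γ w J :=
  fun t ht => hvw t ht ▸ h t ht

theorem IsIntegralCurveOn.hasDerivWithinAt_clm (h : IsIntegralCurveOn γ v J) (l : E →L[ℝ] F)
    {t : ℝ} (ht : t ∈ J) : HasDerivWithinAt (fun s => l (γ s)) (l (v t (γ t))) J t :=
  l.hasFDerivAt.comp_hasDerivWithinAt t (h t ht)

theorem IsIntegralCurve.lipschitzWith {L : ℝ≥0} (h : IsIntegralCurve γ v)
    (hL : ∀ t x, ‖v t x‖ ≤ L) : LipschitzWith L γ :=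
  lipschitzWith_of_nnnorm_deriv_le (fun t => (h t).differentiableAt) fun t => by
    rw [(h t).deriv]
    exact hL t _

theorem IsIntegralCurveOn.eqOn_of_lipschitzWith {K : ℝ≥0} (hv : ∀ t, LipschitzWith K (v t))
    {ρ : ℝ → E} {T : ℝ} (hρ : IsIntegralCurveOn ρ v (Ico 0 T)) (hγ : IsIntegralCurve γ v)
    (h0 : ρ 0 = γ 0) : EqOn ρ γ (Ico 0 T) := by
  intro t ht
  have hsub : Icc 0 t ⊆ Ico 0 T := fun x hx => ⟨hx.1, hx.2.trans_lt ht.2⟩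
  refine ODE_solution_unique (a := 0) (b := t) hv (hρ.continuousOn.mono hsub) (fun s hs => ?_)
    hγ.continuous.continuousOn (fun s _ => (hγ s).hasDerivWithinAt) h0 (right_mem_Icc.2 ht.1)
  refine (hρ s (hsub (Ico_subset_Icc_self hs))).mono_of_mem_nhdsWithin ?_
  filter_upwards [self_mem_nhdsWithin, mem_nhdsWithin_of_mem_nhds (Iio_mem_nhds (hs.2.trans ht.2))]
    with x hx hxT using ⟨hs.1.trans hx, hxT⟩

end IntegralCurve

/-- If `V` decreases at rate `W ∘ γ` along a Lipschitz curve `γ` in a compact set and stays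
nonnegative, then `γ` approaches the zero set of `W`. -/
theorem eventually_mem_thickening_of_dissipation {X : Type*} [PseudoMetricSpace X] {γ : ℝ → X}
    {K : ℝ≥0} (hγ : LipschitzWith K γ) {S : Set X} (hS : IsCompact S) (hγS : ∀ t, γ t ∈ S)
    {W : X → ℝ} (hW : Continuous W) (hW0 : ∀ x, 0 ≤ W x) {V : ℝ → ℝ}
    (hV : ∀ t, HasDerivAt V (-W (γ t)) t) (hV0 : ∀ t, 0 ≤ V t) {ε : ℝ} (hε : 0 < ε) :
    ∀ᶠ t in atTop, γ t ∈ Metric.thickening ε {x ∈ S | W x = 0} := by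
  set Z : Set X := {x ∈ S | W x = 0} with hZ
  have hC : IsCompact (S \ Metric.thickening (ε / 2) Z) := hS.diff Metric.isOpen_thickening
  obtain ⟨m, hm, hmW⟩ := hC.exists_forall_le' (f := W) (a := 0) hW.continuousOn fun x hx =>
    lt_of_le_of_ne (hW0 x) fun h0 =>
      hx.2 (Metric.self_subset_thickening (half_pos hε) Z ⟨hx.1, h0.symm⟩)
  have hanti : Antitone V :=
    antitone_of_hasDerivAt_nonpos hV fun t => neg_nonpos.2 (hW0 _)
  have hlim : Tendsto V atTop (𝓝 (⨅ t, V t)) :=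
    tendsto_atTop_ciInf hanti ⟨0, by rintro _ ⟨t, rfl⟩; exact hV0 t⟩
  -- In time `δ` the curve moves less than `ε / 2`; the `+ 1` covers `K = 0`.
  set δ : ℝ := ε / (2 * (K + 1)) with hδ
  have hδ0 : 0 < δ := by positivity
  have hKδ : K * δ < ε / 2 := by
    have h : (K + 1) * δ = ε / 2 := by rw [hδ]; field_simp
    linarith
  have hdrop : Tendsto (fun t => V t - V (t + δ)) atTop (𝓝 0) := by
    simpa using hlim.sub (hlim.comp (tendsto_atTop_add_const_right atTop δ tendsto_id))
  filter_upwards [hdrop.eventually_lt_const (mul_pos hm hδ0)] with t ht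
  -- If `γ t` is `ε`-far from `Z`, the curve stays `ε / 2`-far on `[t, t + δ]`, where `W ≥ m`; so
  -- `V` drops by at least `m * δ`, contradicting `ht`.
  by_contra hfar
  have hbound : ∀ s ∈ interior (Icc t (t + δ)), deriv V s ≤ -m := by
    intro s hs
    have hs' := interior_subset hs
    rw [(hV s).deriv, neg_le_neg_iff]
    refine hmW _ ⟨hγS s, fun hs2 => hfar ?_⟩
    rw [Metric.mem_thickening_iff] at hs2 ⊢
    obtain ⟨z, hz, hsz⟩ := hs2
    refine ⟨z, hz, ?_⟩
    have h1 : dist (γ t) (γ s) ≤ K * δ := (hγ.dist_le_mul t s).trans <| by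
      gcongr
      rw [Real.dist_eq, abs_le]
      constructor <;> linarith [hs'.1, hs'.2]
    linarith [dist_triangle (γ t) (γ s) z]
  have := (convex_Icc t (t + δ)).image_sub_le_mul_sub_of_deriv_le
    (fun s _ => (hV s).continuousAt.continuousWithinAt)
    (fun s _ => (hV s).differentiableAt.differentiableWithinAt) hbound t
    (left_mem_Icc.2 (by linarith)) (t + δ) (right_mem_Icc.2 (by linarith)) (by linarith)
  linarith

/-! ### The frame potential -/

section Frame

variable {ι E : Type*} [Fintype ι] [NormedAddCommGroup E] [InnerProductSpace ℝ E]

/-- The weighted frame operator `x ↦ ∑ j, c_j² ⟪u_j, x⟫ u_j`. -/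
noncomputable def frameOp (c : ι → ℝ) (u : ι → E) (x : E) : E :=
  ∑ j, c j ^ 2 • inner ℝ (u j) x • u j

/-- The weighted frame potential `¼ ∑ j k, c_j² c_k² ⟪u_j, u_k⟫²`. -/
noncomputable def framePotential (c : ι → ℝ) (u : ι → E) : ℝ :=
  4⁻¹ * ∑ j, ∑ k, c j ^ 2 * c k ^ 2 * inner ℝ (u j) (u k) ^ 2

theorem framePotential_nonneg (c : ι → ℝ) (u : ι → E) : 0 ≤ framePotential c u := by
  unfold framePotential
  positivity

theorem inner_frameOp (c : ι → ℝ) (u : ι → E) (x y : E) :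
    inner ℝ y (frameOp c u x) = ∑ j, c j ^ 2 * (inner ℝ (u j) x * inner ℝ y (u j)) := by
  simp [frameOp, inner_sum, inner_smul_right]

/-- The square gives a factor 2, and by symmetry the two slots of the inner product contribute
equally; together they cancel the `4⁻¹`. -/
theorem hasDerivAt_framePotential {c : ι → ℝ} {u : ℝ → ι → E} {u' : ι → E} {t : ℝ}
    (hu : ∀ i, HasDerivAt (fun s => u s i) (u' i) t) :
    HasDerivAt (fun s => framePotential c (u s))
      (∑ j, c j ^ 2 * inner ℝ (u' j) (frameOp c (u t) (u t j))) t := by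
  have h := (HasDerivAt.fun_sum (u := Finset.univ) fun j _ =>
    HasDerivAt.fun_sum (u := Finset.univ) fun k _ =>
      ((((hu j).inner ℝ (hu k)).fun_pow 2).const_mul (c j ^ 2 * c k ^ 2))).const_mul (4⁻¹ : ℝ)
  refine h.congr_deriv ?_
  set A : ι → ι → ℝ := fun j k =>
    c j ^ 2 * c k ^ 2 * (inner ℝ (u t j) (u t k) * inner ℝ (u' j) (u t k)) with hA
  have hR : ∑ j, c j ^ 2 * inner ℝ (u' j) (frameOp c (u t) (u t j)) = ∑ j, ∑ k, A j k := by
    refine Finset.sum_congr rfl fun j _ => ?_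
    rw [inner_frameOp, Finset.mul_sum]
    refine Finset.sum_congr rfl fun k _ => ?_
    rw [hA, real_inner_comm (u t j) (u t k)]
    ring
  have hswap : ∑ j, ∑ k, A j k = ∑ j, ∑ k, A k j := Finset.sum_comm
  have hsum : ∑ j, ∑ k, c j ^ 2 * c k ^ 2 * ((2 : ℕ) * inner ℝ (u t j) (u t k) ^ (2 - 1) *
      (inner ℝ (u t j) (u' k) + inner ℝ (u' j) (u t k))) =
      2 * ∑ j, ∑ k, A j k + 2 * ∑ j, ∑ k, A k j := by
    simp only [Finset.mul_sum, ← Finset.sum_add_distrib]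
    refine Finset.sum_congr rfl fun j _ => Finset.sum_congr rfl fun k _ => ?_
    simp only [hA]
    rw [real_inner_comm (u t j) (u t k), real_inner_comm (u' k) (u t j)]
    push_cast
    ring
  rw [hR, hsum, ← hswap]
  ring

end Frame

/-! ### The sensor dynamics -/

namespace SensorPlacement

variable {n d : ℕ}

/-- The positions scaled by fixed ranges `R`. -/
noncomputable def scaled (R : Fin n → ℝ) (r : Config n d) (i : Fin n) :
    EuclideanSpace ℝ (Fin d) :=
  (R i)⁻¹ • r i

/-- A polynomial vector field that is tangent to all products of spheres and agrees with the
gradient field on the product of spheres with radii `R`. -/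
noncomputable def tangentField (c R : Fin n → ℝ) (r : Config n d) : Config n d :=
  WithLp.toLp 2 fun i =>
    inner ℝ (scaled R r i) (frameOp c (scaled R r) (scaled R r i)) • scaled R r i -
      -- This coefficient is 1 on the spheres; keeping it makes tangency an identity at every `r`.
      inner ℝ (scaled R r i) (scaled R r i) • frameOp c (scaled R r) (scaled R r i)

theorem matG_mulVec (c : Fin n → ℝ) (r : Config n d) (x : EuclideanSpace ℝ (Fin d)) :
    Matrix.mulVec (matG c r) x.ofLp = (frameOp c (bearing r) x).ofLp := by
  ext k
  simp [matG, frameOp, Matrix.sum_mulVec, Matrix.smul_mulVec, Matrix.vecMulVec_mulVec,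
    Finset.sum_apply, PiLp.inner_apply, dotProduct, mul_comm]

theorem projGrad_eq (c : Fin n → ℝ) (r : Config n d) (i : Fin n) :
    projGrad c r i = frameOp c (bearing r) (bearing r i) -
      inner ℝ (bearing r i) (frameOp c (bearing r) (bearing r i)) • bearing r i := by
  apply WithLp.ofLp_injective 2
  rw [projGrad, Matrix.ofLp_toEuclideanCLM, ← Matrix.mulVec_mulVec, matG_mulVec]
  ext k
  simp [matP, Matrix.sub_mulVec, Matrix.vecMulVec_mulVec, PiLp.inner_apply, dotProduct, mul_comm]

/-- No nonvanishing of `r i` is assumed: a competing solution is not known in advance to avoid the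
singular set. -/
theorem inner_gradField (c : Fin n → ℝ) (r : Config n d) (i : Fin n) :
    inner ℝ (r i) (gradField c r i) = 0 := by
  rcases eq_or_ne (r i) 0 with h | h
  · simp [h]
  have hr : r i = ‖r i‖ • bearing r i := by
    rw [bearing, smul_smul, mul_inv_cancel₀ (norm_ne_zero_iff.2 h), one_smul]
  have h1 : inner ℝ (bearing r i) (bearing r i) = 1 := by
    rw [real_inner_self_eq_norm_sq, bearing, norm_smul, norm_inv, norm_norm,
      inv_mul_cancel₀ (norm_ne_zero_iff.2 h), one_pow]
  have h2 : inner ℝ (bearing r i) (projGrad c r i) = 0 := by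
    rw [projGrad_eq, inner_sub_right, inner_smul_right, h1]
    ring
  rw [hr, inner_smul_left]
  simp [gradField, h2]

theorem inner_tangentField (c R : Fin n → ℝ) (r : Config n d) (i : Fin n) :
    inner ℝ (r i) (tangentField c R r i) = 0 := by
  simp only [tangentField, scaled, inner_sub_right, inner_smul_right, inner_smul_left]
  simp only [conj_trivial]
  ring

theorem contDiff_tangentField (c R : Fin n → ℝ) {m : WithTop ℕ∞} :
    ContDiff ℝ m (tangentField c R : Config n d → Config n d) := by
  have hs : ∀ i, ContDiff ℝ m fun r : Config n d => scaled R r i := fun i =>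
    (contDiff_piLp_apply 2).const_smul _
  have hF : ∀ i, ContDiff ℝ m fun r : Config n d => frameOp c (scaled R r) (scaled R r i) :=
    fun i => ContDiff.sum fun j _ => (((hs j).inner ℝ (hs i)).smul (hs j)).const_smul _
  exact contDiff_piLp' 2 fun i =>
    (((hs i).inner ℝ (hF i)).smul (hs i)).sub (((hs i).inner ℝ (hs i)).smul (hF i))

theorem scaled_eq_bearing {r₀ r : Config n d} (hr : r ∈ spheres r₀) :
    scaled (fun i => ‖r₀ i‖) r = bearing r := by
  ext1 i
  rw [scaled, bearing, hr i]

theorem inner_bearing_self {r₀ r : Config n d} (hr₀ : ∀ i, ‖r₀ i‖ ≠ 0) (hr : r ∈ spheres r₀)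
    (i : Fin n) : inner ℝ (bearing r i) (bearing r i) = 1 := by
  rw [real_inner_self_eq_norm_sq, bearing, norm_smul, norm_inv, norm_norm,
    inv_mul_cancel₀ (hr i ▸ hr₀ i), one_pow]

theorem tangentField_eq_gradField (c : Fin n → ℝ) {r₀ r : Config n d} (hr₀ : ∀ i, ‖r₀ i‖ ≠ 0)
    (hr : r ∈ spheres r₀) : tangentField c (fun i => ‖r₀ i‖) r = gradField c r := by
  apply WithLp.ofLp_injective 2
  ext1 i
  simp only [tangentField, gradField, scaled_eq_bearing hr, inner_bearing_self hr₀ hr,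
    projGrad_eq, one_smul, neg_sub]

/-- The decay rate of the frame potential along the flow. -/
noncomputable def dissipation (c R : Fin n → ℝ) (r : Config n d) : ℝ :=
  ∑ i, c i ^ 2 * (|R i|⁻¹ * ‖tangentField c R r i‖ ^ 2)

theorem dissipation_nonneg (c R : Fin n → ℝ) (r : Config n d) : 0 ≤ dissipation c R r := by
  unfold dissipation
  positivity

theorem continuous_dissipation (c R : Fin n → ℝ) :
    Continuous (dissipation c R : Config n d → ℝ) := by
  have h := (contDiff_tangentField (n := n) (d := d) c R (m := 0)).continuous
  exact continuous_finsetSum _ fun i _ => continuous_const.mul (continuous_const.mul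
    ((((PiLp.continuous_apply 2 _ i).comp h).norm).pow 2))

theorem mem_critSet_of_dissipation_eq_zero {c : Fin n → ℝ} (hc : ∀ i, 0 < c i)
    {r₀ r : Config n d} (hr₀ : ∀ i, ‖r₀ i‖ ≠ 0) (hr : r ∈ spheres r₀)
    (h : dissipation c (fun i => ‖r₀ i‖) r = 0) : r ∈ critSet c r₀ := by
  refine ⟨hr, fun i => ?_⟩
  have h1 := (Finset.sum_eq_zero_iff_of_nonneg (fun i _ => by positivity)).1 h i (Finset.mem_univ i)
  have h2 : tangentField c (fun i => ‖r₀ i‖) r i = 0 := by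
    simpa [(hc i).ne', norm_ne_zero_iff.1 (hr₀ i)] using h1
  rw [tangentField_eq_gradField c hr₀ hr] at h2
  simpa [gradField] using h2

/-- For unit `u_i`, the frame operator sends `u_i` to a multiple of `u_i` minus the tangent velocity
`X_i`. As `X_i ⟂ u_i`, pairing with `u_i' = R_i⁻¹ X_i` leaves `-R_i⁻¹ ‖X_i‖²`. -/
theorem hasDerivAt_framePotential_scaled (c : Fin n → ℝ) {r₀ : Config n d}
    (hr₀ : ∀ i, ‖r₀ i‖ ≠ 0) {r : ℝ → Config n d} {v : ℝ → Config n d → Config n d}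
    (hr : IsIntegralCurve r v) {t : ℝ} (hrt : r t ∈ spheres r₀)
    (hv : v t (r t) = tangentField c (fun i => ‖r₀ i‖) (r t)) :
    HasDerivAt (fun s => framePotential c (scaled (fun i => ‖r₀ i‖) (r s)))
      (-dissipation c (fun i => ‖r₀ i‖) (r t)) t := by
  set R : Fin n → ℝ := fun i => ‖r₀ i‖ with hR
  have hcoord : ∀ i, HasDerivAt (fun s => scaled R (r s) i)
      ((R i)⁻¹ • tangentField c R (r t) i) t := fun i => by
    have h := (hr.isIntegralCurveOn univ).hasDerivWithinAt_clm
      (PiLp.proj 2 (fun _ : Fin n => EuclideanSpace ℝ (Fin d)) (𝕜 := ℝ) i) (mem_univ t)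
    rw [hasDerivWithinAt_univ, hv] at h
    exact HasDerivAt.fun_const_smul (R i)⁻¹ h
  refine (hasDerivAt_framePotential hcoord).congr_deriv ?_
  rw [dissipation, ← Finset.sum_neg_distrib]
  refine Finset.sum_congr rfl fun i _ => ?_
  have h1 : inner ℝ (scaled R (r t) i) (scaled R (r t) i) = 1 := by
    rw [scaled_eq_bearing hrt, inner_bearing_self hr₀ hrt]
  have h2 : inner ℝ (tangentField c R (r t) i) (scaled R (r t) i) = 0 := by
    rw [scaled, inner_smul_right, real_inner_comm, inner_tangentField, mul_zero]
  have h3 : frameOp c (scaled R (r t)) (scaled R (r t) i) =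
      inner ℝ (scaled R (r t) i) (frameOp c (scaled R (r t)) (scaled R (r t) i)) •
        scaled R (r t) i - tangentField c R (r t) i := by
    simp only [tangentField, h1, one_smul, sub_sub_cancel]
  rw [inner_smul_left, h3, inner_sub_right, inner_smul_right, h2, real_inner_self_eq_norm_sq,
    abs_of_nonneg (norm_nonneg (r₀ i))]
  simp only [conj_trivial, hR]
  ring

theorem isCompact_spheres (r₀ : Config n d) : IsCompact (spheres r₀) := by
  refine Metric.isCompact_of_isClosed_isBounded ?_ ?_
  · have h : spheres r₀ = ⋂ i, {r : Config n d | ‖r i‖ = ‖r₀ i‖} := by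
      ext r
      simp [spheres]
    rw [h]
    exact isClosed_iInter fun i => isClosed_eq (by fun_prop) continuous_const
  · refine isBounded_iff_forall_norm_le.2 ⟨‖r₀‖, fun r hr => le_of_eq ?_⟩
    rw [PiLp.norm_eq_of_L2, PiLp.norm_eq_of_L2]
    simp only [hr _]

/-- If the velocity of each position is orthogonal to it, the ranges are conserved. -/
theorem mem_spheres_of_inner_eq_zero {r : ℝ → Config n d} {f : Config n d → Config n d}
    {J : Set ℝ} (hJ : Convex ℝ J) (hr : IsIntegralCurveOn r (fun _ => f) J)
    (h : ∀ r i, inner ℝ (r i) (f r i) = 0) {s t : ℝ} (hs : s ∈ J) (ht : t ∈ J) :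
    r t ∈ spheres (r s) := by
  intro i
  have hsq : ∀ t ∈ J, HasDerivWithinAt (fun s => ‖r s i‖ ^ 2) 0 J t := by
    intro t ht
    simpa [h] using (hr.hasDerivWithinAt_clm
      (PiLp.proj 2 (fun _ : Fin n => EuclideanSpace ℝ (Fin d)) (𝕜 := ℝ) i) ht).norm_sq
  have hconst := hJ.norm_image_sub_le_of_norm_hasDerivWithin_le (C := 0) hsq (by simp) hs ht
  rw [zero_mul, norm_le_zero_iff, sub_eq_zero] at hconst
  exact (pow_left_inj₀ (norm_nonneg _) (norm_nonneg _) two_ne_zero).1 hconst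

/-- The gradient field agrees on the product of spheres with a bounded, globally Lipschitz field
that is tangent to all products of spheres. -/
theorem exists_lipschitz_extension (c : Fin n → ℝ) (r₀ : Config n d) :
    ∃ (f : Config n d → Config n d) (K L : ℝ≥0), LipschitzWith K f ∧ (∀ r, ‖f r‖ ≤ L) ∧
      (∀ r i, inner ℝ (r i) (f r i) = 0) ∧
      ∀ r ∈ spheres r₀, f r = tangentField c (fun i => ‖r₀ i‖) r := by
  obtain ⟨M, hM, hMS⟩ := (isCompact_spheres r₀).isBounded.exists_pos_norm_le
  -- The bump equals 1 on a ball containing the spheres; multiplying by a scalar preserves tangency.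
  let φ : ContDiffBump (0 : Config n d) := ⟨M, M + 1, hM, by linarith⟩
  let f : Config n d → Config n d := fun r => φ r • tangentField c (fun i => ‖r₀ i‖) r
  have hf : ContDiff ℝ 1 f := φ.contDiff.smul (contDiff_tangentField _ _)
  have hsupp : HasCompactSupport f := φ.hasCompactSupport.smul_right
  obtain ⟨K, hK⟩ := hf.lipschitzWith_of_hasCompactSupport hsupp one_ne_zero
  obtain ⟨L, hL⟩ := hsupp.exists_bound_of_continuous hf.continuous
  refine ⟨f, K, L.toNNReal, hK, fun r => (hL r).trans (Real.le_coe_toNNReal L), fun r i => ?_,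
    fun r hr => ?_⟩
  · simp [f, inner_smul_right, inner_tangentField]
  · simp only [f]
    rw [φ.one_of_mem_closedBall (mem_closedBall_zero_iff.2 (hMS r hr)), one_smul]

end SensorPlacement

theorem proposition2 (n d : ℕ) (c : Fin n → ℝ) (hc : ∀ i, 0 < c i)
    (r₀ : SensorPlacement.Config n d) (hr₀ : ∀ i, ‖r₀ i‖ ≠ 0) :
    -- there is a solution on `[0, ∞)`, and every solution on some `[0, T)` is a restriction of it
    ∃ r : ℝ → SensorPlacement.Config n d,
      SensorPlacement.IsSolution c r₀ (Set.Ici 0) r ∧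
      (∀ (T : ℝ) (ρ : ℝ → SensorPlacement.Config n d),
        SensorPlacement.IsSolution c r₀ (Set.Ico 0 T) ρ → Set.EqOn ρ r (Set.Ico 0 T)) ∧
      -- ranges are conserved, that is, the solution stays in the product of spheres
      (∀ t : ℝ, 0 ≤ t → ∀ i, ‖r t i‖ = ‖r₀ i‖) ∧
      -- the solution converges to the critical set
      SensorPlacement.ApproachesSet r (SensorPlacement.critSet c r₀) := by
  obtain ⟨f, K, L, hK, hL, htan, hfS⟩ := SensorPlacement.exists_lipschitz_extension c r₀
  obtain ⟨r, hr0, hr⟩ := exists_isIntegralCurve_of_lipschitzWith hK hL r₀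
  have hS : ∀ t, r t ∈ SensorPlacement.spheres r₀ := fun t => hr0 ▸
    SensorPlacement.mem_spheres_of_inner_eq_zero convex_univ (hr.isIntegralCurveOn univ) htan
      (mem_univ 0) (mem_univ t)
  have hfgrad : ∀ x ∈ SensorPlacement.spheres r₀, f x = SensorPlacement.gradField c x :=
    fun x hx => (hfS x hx).trans (SensorPlacement.tangentField_eq_gradField c hr₀ hx)
  refine ⟨r, ⟨hr0, (hr.isIntegralCurveOn _).congr_field fun t _ => hfgrad _ (hS t)⟩,
    fun T ρ hρ => ?_, fun t _ => hS t, fun ε hε => ?_⟩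
  · have hρS : ∀ s ∈ Ico 0 T, ρ s ∈ SensorPlacement.spheres r₀ := fun s hs => hρ.1 ▸
      SensorPlacement.mem_spheres_of_inner_eq_zero (convex_Ico 0 T) hρ.2
        (SensorPlacement.inner_gradField c) (left_mem_Ico.2 (hs.1.trans_lt hs.2)) hs
    exact (hρ.2.congr_field fun s hs => (hfgrad _ (hρS s hs)).symm).eqOn_of_lipschitzWith
      (fun _ => hK) hr (hρ.1.trans hr0.symm)
  · obtain ⟨T, hT⟩ := eventually_atTop.1 <| eventually_mem_thickening_of_dissipation
      (hr.lipschitzWith fun _ => hL) (SensorPlacement.isCompact_spheres r₀) hS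
      (SensorPlacement.continuous_dissipation c _) (SensorPlacement.dissipation_nonneg c _)
      (fun t => SensorPlacement.hasDerivAt_framePotential_scaled c hr₀ hr (hS t) (hfS _ (hS t)))
      (fun t => framePotential_nonneg c _) hε
    refine ⟨T, fun t ht => ?_⟩
    obtain ⟨e, he, hd⟩ := Metric.mem_thickening_iff.1 (hT t ht)
    exact ⟨e, SensorPlacement.mem_critSet_of_dissipation_eq_zero hc hr₀ he.1 he.2, hd⟩
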